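/- Let $d\ge 1$, let $\Omega\subset\mathbb R^d$ be a bounded open set (for instance a bounded Lipschitz domain) and let $\tau>0$. Let $H_0^1(\Omega)$ be the closure of $C_c^\infty(\Omega)$ in $H^1(\Omega)$, let $H^{-1}(\Omega)$ be the space of bounded linear functionals on $H_0^1(\Omega)$, and put $$\|R\|_{-1}=\sup_{v\in H_0^1(\Omega),\,v\ne 0}\frac{|R(v)|}{\|\nabla v\|_{L^2(\Omega)}},\qquad R\in H^{-1}(\Omega).$$ Then there are constants $c,C>0$, depending only on $\Omega$ and $\tau$, such that the following holds. Let $(\lambda_k,\phi_k)_{k\ge1}$ be any eigensystem of the Dirichlet Laplacian on $\Omega$: $(\lambda_k)$ is non-decreasing, $\phi_k\in H_0^1(\Omega)$, $-\Delta\phi_k=\lambda_k\phi_k$ weakly in $\Omega$, and $(\phi_k)$ is an orthonormal basis of $L^2(\Omega)$. Let $(w_k)_{k\ge1}$ be independent real random variables with mean $0$ and variance $1$ on a probability space $(\Xi,\mathfrak F,\mu)$, and let $$\Phi^{(n)}(\xi)=\tau\sum_{k=1}^n(1+\lambda_k)^{-1/2}\,w_k(\xi)\,\phi_k\in H_0^1(\Omega).$$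 Then for every $R\in H^{-1}(\Omega)$ (in particular for every weak residual $R_u=Lu-f$ with $u\in H_0^1(\Omega)$, $f\in H^{-1}(\Omega)$ and an operator $L$ with $Lu\in H^{-1}(\Omega)$): 1. $R(\Phi):=\lim_{n\to\infty}R(\Phi^{(n)})$ exists and is finite $\mu$-almost surely; 2. the limit $\|R\|_\Phi^2:=\lim_{n\to\infty}\mathbb E\,|R(\Phi^{(n)})|^2$ exists and is finite; 3. $\|R\|_{-1}^2=\sum_{k=1}^\infty\lambda_k^{-1}|R(\phi_k)|^2$; 4. $c\,\|R\|_\Phi^2\le\|R\|_{-1}^2\le C\,\|R\|_\Phi^2$. -/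

import Mathlib

open MeasureTheory ProbabilityTheory Filter Topology TopologicalSpace
open scoped Distributions Gradient InnerProductSpace

noncomputable section

/-- Euclidean space `ℝ^d`. -/
abbrev Eucl (d : ℕ) : Type := EuclideanSpace ℝ (Fin d)

/-- The real Hilbert space `L²(Ω)` (Lebesgue measure). -/
abbrev L2 {d : ℕ} (Ω : Opens (Eucl d)) : Type :=
  Lp ℝ 2 ((volume : Measure (Eucl d)).restrict (Ω : Set (Eucl d)))

/-- The real Hilbert space `L²(Ω; ℝ^d)` of square-integrable vector fields. -/
abbrev L2Vec {d : ℕ} (Ω : Opens (Eucl d)) : Type :=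
  Lp (Eucl d) 2 ((volume : Measure (Eucl d)).restrict (Ω : Set (Eucl d)))

theorem testFun_memLp {d : ℕ} (Ω : Opens (Eucl d)) (ψ : 𝓓(Ω, ℝ)) :
    MemLp (ψ : Eucl d → ℝ) 2
      ((volume : Measure (Eucl d)).restrict (Ω : Set (Eucl d))) :=
  ψ.contDiff.continuous.memLp_of_hasCompactSupport ψ.hasCompactSupport

theorem testFun_gradient_memLp {d : ℕ} (Ω : Opens (Eucl d)) (ψ : 𝓓(Ω, ℝ)) :
    MemLp (∇ (ψ : Eucl d → ℝ)) 2
      ((volume : Measure (Eucl d)).restrict (Ω : Set (Eucl d))) := by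
  have h1 : Continuous (fderiv ℝ (ψ : Eucl d → ℝ)) :=
    ψ.contDiff.continuous_fderiv (by simp)
  have h2 : HasCompactSupport (fderiv ℝ (ψ : Eucl d → ℝ)) :=
    ψ.hasCompactSupport.fderiv (𝕜 := ℝ)
  refine Continuous.memLp_of_hasCompactSupport ?_ ?_
  · exact (InnerProductSpace.toDual ℝ (Eucl d)).symm.continuous.comp h1
  · exact h2.comp_left
      (g := fun l => (InnerProductSpace.toDual ℝ (Eucl d)).symm l) (map_zero _)

/-- The pair `(ψ, ∇ψ) ∈ L²(Ω) × L²(Ω; ℝ^d)` of a test function `ψ ∈ C_c^∞(Ω)`. The Hilbert norm of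
the pair is the norm `(‖ψ‖² + ‖∇ψ‖²)^{1/2}` of `ψ` in `H¹(Ω)`. -/
def testPair {d : ℕ} (Ω : Opens (Eucl d)) (ψ : 𝓓(Ω, ℝ)) : WithLp 2 (L2 Ω × L2Vec Ω) :=
  WithLp.toLp 2 ((testFun_memLp Ω ψ).toLp ψ, (testFun_gradient_memLp Ω ψ).toLp (∇ ψ))

/-- The Sobolev space `H₀¹(Ω)`: the closure of `C_c^∞(Ω)` in the norm of `H¹(Ω)`, where
`v ∈ H¹(Ω)` is represented by the pair `(v, ∇v)` of `v` and its weak gradient. (The pairs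
`(ψ, ∇ψ)` already form a subspace; `span` only packages them as one.) -/
def H01 {d : ℕ} (Ω : Opens (Eucl d)) : Submodule ℝ (WithLp 2 (L2 Ω × L2Vec Ω)) :=
  (Submodule.span ℝ (Set.range (testPair Ω))).topologicalClosure

/-- An element of `H₀¹(Ω)`, as an element of `L²(Ω)`. -/
def H01.val {d : ℕ} {Ω : Opens (Eucl d)} (v : H01 Ω) : L2 Ω :=
  (v : WithLp 2 (L2 Ω × L2Vec Ω)).fst

/-- The weak gradient of an element of `H₀¹(Ω)`. -/
def H01.grad {d : ℕ} {Ω : Opens (Eucl d)} (v : H01 Ω) : L2Vec Ω :=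
  (v : WithLp 2 (L2 Ω × L2Vec Ω)).snd

/-- `H⁻¹(Ω)`, the bounded linear functionals on `H₀¹(Ω)`. -/
abbrev HNegOne {d : ℕ} (Ω : Opens (Eucl d)) : Type := StrongDual ℝ (H01 Ω)

/-- The dual norm `‖R‖_{-1} = sup_{v ∈ H₀¹(Ω), v ≠ 0} |R v| / ‖∇v‖_{L²}`. -/
def dualNorm {d : ℕ} {Ω : Opens (Eucl d)} (R : HNegOne Ω) : ℝ :=
  ⨆ v : {v : H01 Ω // v ≠ 0}, |R v| / ‖H01.grad (v : H01 Ω)‖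

/-- `(lam k, φ k)`, `k = 0, 1, …`, is the spectral decomposition of the Dirichlet Laplacian of `Ω`:
the eigenvalues are listed in non-decreasing order, the eigenfunctions form an orthonormal basis of
`L²(Ω)`, belong to `H₀¹(Ω)`, and satisfy `-Δ(φ k) = lam k • φ k` weakly in `Ω`. -/
structure IsDirichletEigensystem {d : ℕ} (Ω : Opens (Eucl d)) (lam : ℕ → ℝ) (φ : ℕ → H01 Ω) :
    Prop where
  mono : Monotone lam
  orthonormal : Orthonormal ℝ (fun k => H01.val (φ k))
  complete : (Submodule.span ℝ (Set.range fun k => H01.val (φ k))).topologicalClosure = ⊤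
  weak_eigen : ∀ (k : ℕ) (v : H01 Ω),
    ⟪H01.grad (φ k), H01.grad v⟫_ℝ = lam k * ⟪H01.val (φ k), H01.val v⟫_ℝ

/-- The partial sum `Φ⁽ⁿ⁾(ξ) = τ ∑_{k < n} (1 + lam k)^{-1/2} w_k(ξ) φ_k ∈ H₀¹(Ω)` of the random
series `Φ`. -/
def randomPartialSum {d : ℕ} {Ω : Opens (Eucl d)} {Ξ : Type*} (τ : ℝ) (lam : ℕ → ℝ)
    (φ : ℕ → H01 Ω) (w : ℕ → Ξ → ℝ) (n : ℕ) (ξ : Ξ) : H01 Ω :=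
  τ • ∑ k ∈ Finset.range n, ((1 + lam k) ^ (-(1 / 2) : ℝ) * w k ξ) • φ k

/-- `‖R‖_Φ² = lim_n E|R(Φ⁽ⁿ⁾)|²`. -/
def stochNormSq {d : ℕ} {Ω : Opens (Eucl d)} {Ξ : Type*} [MeasurableSpace Ξ] (μ : Measure Ξ)
    (τ : ℝ) (lam : ℕ → ℝ) (φ : ℕ → H01 Ω) (w : ℕ → Ξ → ℝ) (R : HNegOne Ω) : ℝ :=
  limUnder atTop fun n : ℕ => ∫ ξ, |R (randomPartialSum τ lam φ w n ξ)| ^ 2 ∂μ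

end

/-!
Everything takes place in `H₀¹(Ω)` with the energy inner product `⟪∇u, ∇v⟫`.

As `Ω` is bounded, the Poincaré inequality `‖v‖ ≤ P ‖∇v‖` holds on `H₀¹(Ω)` (`H01.poincare`), so the
gradient has closed range and `H₀¹(Ω)` is a Hilbert space for the energy inner product. Tested with
`φ k` it gives `1 ≤ P² lam k`: the eigenvalues stay away from `0`, by a bound that depends on `Ω`
only. The weak eigenvalue equation makes the `(lam k)^{-1/2} φ k` orthonormal for the energy. They
are complete: a `v` orthogonal to all of them in energy is so in `L²(Ω)` and vanishes there, and then
`∇v = 0`, since the gradient is closable (`H01.grad_eq_zero`). By the Riesz theorem the dual norm of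
`R` is the norm of its representative, and Parseval's identity (`hasSum_sq_iSup_div_norm`) turns this
into `‖R‖_{-1}² = ∑ (lam k)⁻¹ (R (φ k))²`.

On the other side `R(Φ⁽ⁿ⁾) = ∑_{k < n} a k * w k` with `(a k)² = τ² (1 + lam k)⁻¹ (R (φ k))²`.
Independence gives `E |R(Φ⁽ⁿ⁾)|² = ∑_{k < n} (a k)²`. From
`(1 + lam k)⁻¹ ≤ (lam k)⁻¹ ≤ (1 + P²) (1 + lam k)⁻¹` one reads off the equivalence of the norms, and
that `∑ (a k)²` is finite; almost sure convergence is then Kolmogorov's one-series theorem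
(`ae_exists_tendsto_sum_mul`).
-/

/-! ### Test functions and closed conditions on `H₀¹(Ω)` -/

theorem inner_toLp_toLp {α E : Type*} [MeasurableSpace α] {μ : Measure α}
    [NormedAddCommGroup E] [InnerProductSpace ℝ E] {f g : α → E}
    (hf : MemLp f 2 μ) (hg : MemLp g 2 μ) :
    ⟪hf.toLp f, hg.toLp g⟫_ℝ = ∫ x, ⟪f x, g x⟫_ℝ ∂μ := by
  rw [L2.inner_def]
  refine integral_congr_ae ?_
  filter_upwards [hf.coeFn_toLp, hg.coeFn_toLp] with x h1 h2
  rw [h1, h2]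

theorem norm_toLp_sq {α E : Type*} [MeasurableSpace α] {μ : Measure α}
    [NormedAddCommGroup E] [InnerProductSpace ℝ E] {f : α → E} (hf : MemLp f 2 μ) :
    ‖hf.toLp f‖ ^ 2 = ∫ x, ‖f x‖ ^ 2 ∂μ := by
  rw [← real_inner_self_eq_norm_sq, inner_toLp_toLp]
  simp_rw [real_inner_self_eq_norm_sq]

theorem gradient_test_add {d : ℕ} {Ω : Opens (Eucl d)} (ψ η : 𝓓(Ω, ℝ)) :
    ∇ ((ψ + η : 𝓓(Ω, ℝ)) : Eucl d → ℝ) = ∇ (ψ : Eucl d → ℝ) + ∇ (η : Eucl d → ℝ) := by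
  funext x
  have h1 : DifferentiableAt ℝ ψ x := ψ.contDiff.differentiable (by simp) x
  have h2 : DifferentiableAt ℝ η x := η.contDiff.differentiable (by simp) x
  have : ((ψ + η : 𝓓(Ω, ℝ)) : Eucl d → ℝ) = (ψ : Eucl d → ℝ) + η := rfl
  simp [gradient, this, fderiv_add h1 h2]

theorem gradient_test_smul {d : ℕ} {Ω : Opens (Eucl d)} (c : ℝ) (ψ : 𝓓(Ω, ℝ)) :
    ∇ ((c • ψ : 𝓓(Ω, ℝ)) : Eucl d → ℝ) = c • ∇ (ψ : Eucl d → ℝ) := by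
  funext x
  have h1 : DifferentiableAt ℝ ψ x := ψ.contDiff.differentiable (by simp) x
  have : ((c • ψ : 𝓓(Ω, ℝ)) : Eucl d → ℝ) = c • (ψ : Eucl d → ℝ) := rfl
  simp [gradient, this, fderiv_const_smul h1 c]

/-- `testPair` as a linear map; its range is therefore all of the span used to define `H01`. -/
noncomputable def testPairLin {d : ℕ} (Ω : Opens (Eucl d)) :
    𝓓(Ω, ℝ) →ₗ[ℝ] WithLp 2 (L2 Ω × L2Vec Ω) where
  toFun := testPair Ω
  map_add' ψ η := by
    simp only [testPair, gradient_test_add]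
    rfl
  map_smul' c ψ := by
    simp only [testPair, gradient_test_smul]
    rfl

/-- A closed condition on pairs holds on `H₀¹(Ω)` as soon as it holds for `(ψ, ∇ψ)`. -/
theorem H01.closed_induction {d : ℕ} {Ω : Opens (Eucl d)} {p : WithLp 2 (L2 Ω × L2Vec Ω) → Prop}
    (hp : IsClosed {x | p x}) (h : ∀ ψ, p (testPair Ω ψ)) (v : H01 Ω) : p v := by
  have hspan : (Submodule.span ℝ (Set.range (testPair Ω)) : Set (WithLp 2 (L2 Ω × L2Vec Ω)))
      = Set.range (testPair Ω) := by
    have : Set.range (testPair Ω) = ((testPairLin Ω).range : Set _) := rfl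
    rw [this, Submodule.span_eq]
  have hv : (v : WithLp 2 (L2 Ω × L2Vec Ω)) ∈ closure (Set.range (testPair Ω)) := by
    have : (v : WithLp 2 (L2 Ω × L2Vec Ω)) ∈
      (Submodule.span ℝ (Set.range (testPair Ω))).topologicalClosure := v.2
    rwa [← SetLike.mem_coe, Submodule.topologicalClosure_coe, hspan] at this
  exact closure_minimal (by rintro _ ⟨ψ, rfl⟩; exact h ψ) hp hv

/-! ### The Poincaré inequality -/

theorem test_eq_zero_of_notMem {d : ℕ} {Ω : Opens (Eucl d)} (ψ : 𝓓(Ω, ℝ)) {x : Eucl d}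
    (hx : x ∉ Ω) : ψ x = 0 :=
  image_eq_zero_of_notMem_tsupport fun h => hx (ψ.tsupport_subset h)

theorem fderiv_test_eq_zero_of_notMem {d : ℕ} {Ω : Opens (Eucl d)} (ψ : 𝓓(Ω, ℝ)) {x : Eucl d}
    (hx : x ∉ Ω) : fderiv ℝ ψ x = 0 :=
  image_eq_zero_of_notMem_tsupport
    fun h => hx (ψ.tsupport_subset (tsupport_fderiv_subset ℝ h))

theorem norm_gradient {d : ℕ} (f : Eucl d → ℝ) (x : Eucl d) : ‖∇ f x‖ = ‖fderiv ℝ f x‖ := by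
  simp [gradient]

theorem integrable_of_eq_zero_imp {d : ℕ} {E F : Type*} [NormedAddCommGroup E]
    [NormedAddCommGroup F] {f : Eucl d → E} {g : Eucl d → F} (hf : HasCompactSupport f)
    (hg : Continuous g) (h : ∀ x, f x = 0 → g x = 0) : Integrable g :=
  hg.integrable_of_hasCompactSupport (hf.mono fun x hx hfx => hx (h x hfx))

/-- The Poincaré inequality for a test function: integrate `ψ² = ψ² ∂₀(x₀)` by parts and absorb
`∫ ψ²` with `2 |x₀ ψ ∂₀ψ| ≤ ψ² / 2 + 2 r² |∇ψ|²`. -/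
theorem poincare_test {d : ℕ} (hd : 1 ≤ d) {Ω : Opens (Eucl d)} {r : ℝ}
    (hr : ∀ x ∈ Ω, ‖x‖ ≤ r) (ψ : 𝓓(Ω, ℝ)) :
    ∫ x, ψ x ^ 2 ≤ 4 * r ^ 2 * ∫ x, ‖fderiv ℝ ψ x‖ ^ 2 := by
  let i : Fin d := ⟨0, hd⟩
  let e : Eucl d := EuclideanSpace.single i 1
  have he : ‖e‖ = 1 := by simp [e]
  have hc : Continuous ψ := ψ.continuous
  have hs : HasCompactSupport ψ := ψ.hasCompactSupport
  have hc' : Continuous (fderiv ℝ ψ) := ψ.contDiff.continuous_fderiv (by simp)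
  have hs' : HasCompactSupport (fderiv ℝ ψ) := hs.fderiv (𝕜 := ℝ)
  have hdiff : Differentiable ℝ ψ := ψ.contDiff.differentiable (by simp)
  have hfd : ∀ x, fderiv ℝ (fun x => ψ x ^ 2) x e = 2 * ψ x * fderiv ℝ ψ x e := fun x => by
    rw [((hdiff x).hasFDerivAt.pow 2).fderiv]; simp
  have hx : ∀ x : Eucl d, fderiv ℝ (fun x : Eucl d => x i) x e = 1 := fun x => by
    have : HasFDerivAt (fun x : Eucl d => x i) (EuclideanSpace.proj i : Eucl d →L[ℝ] ℝ) x :=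
      (EuclideanSpace.proj i : Eucl d →L[ℝ] ℝ).hasFDerivAt
    rw [this.fderiv]; simp [e]
  have hci : Continuous fun x : Eucl d => x i := (EuclideanSpace.proj i : Eucl d →L[ℝ] ℝ).continuous
  have hint : Integrable fun x => ψ x ^ 2 :=
    integrable_of_eq_zero_imp hs (hc.pow 2) fun x hx => by simp [hx]
  have hint' : Integrable fun x => ‖fderiv ℝ ψ x‖ ^ 2 :=
    integrable_of_eq_zero_imp hs' (hc'.norm.pow 2) fun x hx => by simp [hx]
  have hint1 : Integrable fun x => 2 * ψ x * fderiv ℝ ψ x e * x i :=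
    integrable_of_eq_zero_imp hs
      (((continuous_const.mul hc).mul (hc'.clm_apply continuous_const)).mul hci)
      fun x hx => by simp [hx]
  have hint2 : Integrable fun x => ψ x ^ 2 * x i :=
    integrable_of_eq_zero_imp hs ((hc.pow 2).mul hci) fun x hx => by simp [hx]
  have key := integral_mul_fderiv_eq_neg_fderiv_mul_of_integrable (μ := volume)
    (f := fun x => ψ x ^ 2) (g := fun x : Eucl d => x i) (v := e)
    (by simpa only [hfd] using hint1) (by simpa only [hx, mul_one] using hint) hint2
    (fun x _ => (hdiff x).pow 2)
    (fun x _ => (EuclideanSpace.proj i : Eucl d →L[ℝ] ℝ).differentiableAt)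
  simp only [hfd, hx, mul_one, ← integral_neg] at key
  have hle : ∀ x, -(2 * ψ x * fderiv ℝ ψ x e * x i)
      ≤ 2⁻¹ * ψ x ^ 2 + 2 * r ^ 2 * ‖fderiv ℝ ψ x‖ ^ 2 := fun x => by
    by_cases hxΩ : x ∈ Ω
    · have h1 : |fderiv ℝ ψ x e| ≤ ‖fderiv ℝ ψ x‖ := by
        simpa [he] using (fderiv ℝ ψ x).le_opNorm e
      have h2 : |x i| ≤ r := (PiLp.norm_apply_le x i).trans (hr x hxΩ)
      have h3 : (fderiv ℝ ψ x e * x i) ^ 2 ≤ r ^ 2 * ‖fderiv ℝ ψ x‖ ^ 2 := by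
        rw [← sq_abs, abs_mul, ← mul_pow, mul_comm r]
        gcongr
      nlinarith [sq_nonneg (ψ x + 2 * (fderiv ℝ ψ x e * x i))]
    · simp [test_eq_zero_of_notMem ψ hxΩ]
      positivity
  have := integral_mono hint1.neg ((hint.const_mul 2⁻¹).add (hint'.const_mul (2 * r ^ 2))) hle
  simp only [Pi.neg_apply, Pi.add_apply] at this
  rw [← key, integral_add (hint.const_mul _) (hint'.const_mul _), integral_const_mul,
    integral_const_mul] at this
  linarith

/-- The Poincaré inequality on `H₀¹(Ω)`, for `Ω` in a ball of radius `r`. -/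
theorem H01.poincare {d : ℕ} (hd : 1 ≤ d) {Ω : Opens (Eucl d)} {r : ℝ} (hr0 : 0 ≤ r)
    (hr : ∀ x ∈ Ω, ‖x‖ ≤ r) (v : H01 Ω) : ‖H01.val v‖ ≤ 2 * r * ‖H01.grad v‖ := by
  refine H01.closed_induction (p := fun x => ‖x.fst‖ ≤ 2 * r * ‖x.snd‖) ?_ (fun ψ => ?_) v
  · exact isClosed_le (WithLp.fstL 2 ℝ (L2 Ω) (L2Vec Ω)).continuous.norm
      (continuous_const.mul (WithLp.sndL 2 ℝ (L2 Ω) (L2Vec Ω)).continuous.norm)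
  · refine le_of_sq_le_sq ?_ (by positivity)
    have h := poincare_test hd hr ψ
    simp only [testPair, WithLp.toLp_fst, WithLp.toLp_snd]
    rw [mul_pow, norm_toLp_sq, norm_toLp_sq,
      setIntegral_eq_integral_of_forall_compl_eq_zero
        (fun x hx => by simp [test_eq_zero_of_notMem ψ hx]),
      setIntegral_eq_integral_of_forall_compl_eq_zero
        (fun x hx => by rw [norm_gradient, fderiv_test_eq_zero_of_notMem ψ hx]; simp)]
    simp only [norm_gradient, Real.norm_eq_abs, sq_abs]
    linarith

/-! ### Closability of the gradient -/

theorem integral_test_mul_fderiv {d : ℕ} {Ω : Opens (Eucl d)} (ψ η : 𝓓(Ω, ℝ)) (e : Eucl d) :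
    ∫ x, ψ x * fderiv ℝ η x e = -∫ x, fderiv ℝ ψ x e * η x := by
  have hc : Continuous (fderiv ℝ ψ) := ψ.contDiff.continuous_fderiv (by simp)
  have hc' : Continuous (fderiv ℝ η) := η.contDiff.continuous_fderiv (by simp)
  have hψ : Continuous ψ := ψ.continuous
  have hη : Continuous η := η.continuous
  refine integral_mul_fderiv_eq_neg_fderiv_mul_of_integrable ?_ ?_ ?_
    (fun x _ => ψ.contDiff.differentiable (by simp) x)
    (fun x _ => η.contDiff.differentiable (by simp) x)
  · exact Continuous.integrable_of_hasCompactSupport (by fun_prop) η.hasCompactSupport.mul_left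
  · exact Continuous.integrable_of_hasCompactSupport (by fun_prop) ψ.hasCompactSupport.mul_right
  · exact Continuous.integrable_of_hasCompactSupport (by fun_prop) η.hasCompactSupport.mul_left

theorem memLp_smul_const_test {d : ℕ} {Ω : Opens (Eucl d)} (η : 𝓓(Ω, ℝ)) (e : Eucl d) :
    MemLp (fun x => η x • e) 2 ((volume : Measure (Eucl d)).restrict (Ω : Set (Eucl d))) := by
  have hη : Continuous η := η.continuous
  exact Continuous.memLp_of_hasCompactSupport (by fun_prop) η.hasCompactSupport.smul_right

theorem memLp_fderiv_test {d : ℕ} {Ω : Opens (Eucl d)} (η : 𝓓(Ω, ℝ)) (e : Eucl d) :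
    MemLp (fun x => fderiv ℝ η x e) 2
      ((volume : Measure (Eucl d)).restrict (Ω : Set (Eucl d))) := by
  have hc' : Continuous (fderiv ℝ η) := η.contDiff.continuous_fderiv (by simp)
  refine Continuous.memLp_of_hasCompactSupport (by fun_prop) ?_
  exact (η.hasCompactSupport.fderiv (𝕜 := ℝ)).comp_left (g := fun l => l e) (by simp)

/-- The second component of an element of `H₀¹(Ω)` is the weak gradient of the first. -/
theorem H01.inner_val_eq_neg {d : ℕ} {Ω : Opens (Eucl d)} (v : H01 Ω) (η : 𝓓(Ω, ℝ))
    (e : Eucl d) :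
    ⟪H01.val v, (memLp_fderiv_test η e).toLp _⟫_ℝ
      = -⟪H01.grad v, (memLp_smul_const_test η e).toLp _⟫_ℝ := by
  refine H01.closed_induction (p := fun x => ⟪x.fst, (memLp_fderiv_test η e).toLp _⟫_ℝ
      = -⟪x.snd, (memLp_smul_const_test η e).toLp _⟫_ℝ) ?_ (fun ψ => ?_) v
  · exact isClosed_eq ((WithLp.fstL 2 ℝ (L2 Ω) (L2Vec Ω)).continuous.inner continuous_const)
      ((WithLp.sndL 2 ℝ (L2 Ω) (L2Vec Ω)).continuous.inner continuous_const).neg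
  · simp only [testPair, WithLp.toLp_fst, WithLp.toLp_snd]
    rw [inner_toLp_toLp, inner_toLp_toLp]
    simp only [inner_smul_right, inner_gradient_left]
    rw [setIntegral_eq_integral_of_forall_compl_eq_zero
        (fun x hx => by simp [test_eq_zero_of_notMem ψ hx]),
      setIntegral_eq_integral_of_forall_compl_eq_zero
        (fun x hx => by simp [test_eq_zero_of_notMem η hx])]
    simpa [mul_comm] using integral_test_mul_fderiv ψ η e

/-- The gradient is closable: an element of `H₀¹(Ω)` that vanishes in `L²(Ω)` has zero gradient. -/
theorem H01.grad_eq_zero {d : ℕ} {Ω : Opens (Eucl d)} {v : H01 Ω} (hv : H01.val v = 0) :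
    H01.grad v = 0 := by
  have hcoord : ∀ i : Fin d, ∀ᵐ x ∂(volume : Measure (Eucl d)), x ∈ (Ω : Set (Eucl d)) →
      H01.grad v x i = 0 := fun i => by
    have hmem : MemLp (fun x => H01.grad v x i) 2
        ((volume : Measure (Eucl d)).restrict (Ω : Set (Eucl d))) :=
      (EuclideanSpace.proj i : Eucl d →L[ℝ] ℝ).comp_memLp' (Lp.memLp (H01.grad v))
    refine Ω.isOpen.ae_eq_zero_of_integral_contDiff_smul_eq_zero ?_ fun g hg hgs hgΩ => ?_
    · exact locallyIntegrableOn_of_locallyIntegrable_restrict (hmem.locallyIntegrable (by norm_num))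
    · let η : 𝓓(Ω, ℝ) := ⟨g, hg, hgs, hgΩ⟩
      have h := H01.inner_val_eq_neg v η (EuclideanSpace.single i 1)
      rw [hv, inner_zero_left, eq_comm, neg_eq_zero, L2.inner_def] at h
      rw [← setIntegral_eq_integral_of_forall_compl_eq_zero (s := (Ω : Set (Eucl d)))
        (fun x hx => by
          have : g x = 0 := test_eq_zero_of_notMem η hx
          simp [this]), ← h]
      refine integral_congr_ae ?_
      filter_upwards [(memLp_smul_const_test η (EuclideanSpace.single i 1)).coeFn_toLp] with x hx
      rw [hx]
      simp [inner_smul_right, EuclideanSpace.inner_single_right, η]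
  rw [Lp.eq_zero_iff_ae_eq_zero]
  have : ∀ᵐ x ∂(volume : Measure (Eucl d)).restrict (Ω : Set (Eucl d)),
      ∀ i, H01.grad v x i = 0 := by
    rw [ae_restrict_iff' Ω.isOpen.measurableSet]
    filter_upwards [ae_all_iff.2 hcoord] with x hx h i using hx i h
  filter_upwards [this] with x hx
  ext i
  simpa using hx i

/-! ### Parseval's identity for dual norms -/

/-- Parseval's identity for the dual norm: if `G` is bounded below and `(φ k)` is orthogonal and
total for the form `⟪G ·, G ·⟫`, with `‖G (φ k)‖² = lam k`, then the square of the norm of `R`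
with respect to `‖G ·‖` is `∑ (R (φ k))² / lam k`. -/
theorem hasSum_sq_iSup_div_norm {V F : Type*} [NormedAddCommGroup V] [NormedSpace ℝ V]
    [CompleteSpace V] [NormedAddCommGroup F] [InnerProductSpace ℝ F] [CompleteSpace F]
    (G : V →L[ℝ] F) {K : ℝ} (hK : ∀ v, ‖v‖ ≤ K * ‖G v‖) {φ : ℕ → V} {lam : ℕ → ℝ}
    (hlam : ∀ k, 0 < lam k) (hself : ∀ k, ‖G (φ k)‖ ^ 2 = lam k)
    (horth : Pairwise fun i j => ⟪G (φ i), G (φ j)⟫_ℝ = 0)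
    (htotal : ∀ v, (∀ k, ⟪G (φ k), G v⟫_ℝ = 0) → G v = 0) (R : V →L[ℝ] ℝ) :
    HasSum (fun k => (lam k)⁻¹ * |R (φ k)| ^ 2)
      ((⨆ v : {v : V // v ≠ 0}, |R v| / ‖G (v : V)‖) ^ 2) := by
  have hK' : ∀ v, ‖v‖ ≤ (K.toNNReal : ℝ) * ‖G v‖ := fun v =>
    (hK v).trans (by gcongr; exact Real.le_coe_toNNReal K)
  have hanti : AntilipschitzWith K.toNNReal G := G.antilipschitz_of_bound hK'
  have hclosed : IsClosed (Set.range G) := hanti.isClosed_range G.uniformContinuous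
  let T : V ≃L[ℝ] G.range := G.equivRange hanti.injective hclosed
  have : CompleteSpace G.range :=
    (completeSpace_coe_iff_isComplete (s := Set.range G)).2 hclosed.isComplete
  have hT : ∀ v, ((T v : G.range) : F) = G v := fun v => rfl
  let r : G.range := (InnerProductSpace.toDual ℝ G.range).symm (R ∘L (T.symm : G.range →L[ℝ] V))
  have hr : ∀ v, ⟪r, T v⟫_ℝ = R v := fun v => by simp [r]
  let e : ℕ → G.range := fun k => (√(lam k))⁻¹ • T (φ k)
  have he : Orthonormal ℝ e := by
    refine ⟨fun k => ?_, fun i j hij => ?_⟩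
    · have : ‖T (φ k)‖ = √(lam k) := by
        rw [← hself k, Real.sqrt_sq (norm_nonneg _), ← hT, Submodule.coe_norm]
      have hpos := Real.sqrt_pos.2 (hlam k)
      simp only [e, norm_smul, this, norm_inv, Real.norm_eq_abs, abs_of_pos hpos]
      exact inv_mul_cancel₀ hpos.ne'
    · simp only [e, inner_smul_left, inner_smul_right, Submodule.coe_inner, hT, horth hij, mul_zero]
  have hsp : (Submodule.span ℝ (Set.range e))ᗮ = ⊥ := by
    rw [Submodule.eq_bot_iff]
    intro x hx
    obtain ⟨v, rfl⟩ := T.surjective x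
    have : G v = 0 := htotal v fun k => by
      have h := hx (e k) (Submodule.subset_span ⟨k, rfl⟩)
      simp only [e, inner_smul_left, Submodule.coe_inner, hT, mul_eq_zero] at h
      exact h.resolve_left (by simpa using (Real.sqrt_pos.2 (hlam k)).ne')
    exact Subtype.ext this
  have hsum := (HilbertBasis.mkOfOrthogonalEqBot he hsp).hasSum_inner_mul_inner r r
  have hnorm : (⨆ v : {v : V // v ≠ 0}, |R v| / ‖G (v : V)‖) = ‖r‖ := by
    have hle : ∀ v : {v : V // v ≠ 0}, |R v| / ‖G (v : V)‖ ≤ ‖r‖ := fun v =>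
      div_le_of_le_mul₀ (norm_nonneg _) (norm_nonneg _) (by
        rw [← hr, ← hT, ← Submodule.coe_norm]; exact abs_real_inner_le_norm _ _)
    refine le_antisymm (Real.iSup_le hle (norm_nonneg _)) ?_
    by_cases h0 : r = 0
    · rw [h0, norm_zero]
      exact Real.iSup_nonneg fun v => by positivity
    · -- the Riesz representative attains the supremum
      refine le_ciSup_of_le ⟨‖r‖, by rintro _ ⟨v, rfl⟩; exact hle v⟩
        ⟨T.symm r, by simpa using h0⟩ ?_
      have h1 : R (T.symm r) = ‖r‖ ^ 2 := by
        rw [← hr, T.apply_symm_apply, real_inner_self_eq_norm_sq]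
      have h2 : ‖G (T.symm r)‖ = ‖r‖ := by
        rw [← hT, T.apply_symm_apply, Submodule.coe_norm]
      simp only [h1, h2, abs_pow, abs_norm]
      rw [sq, mul_div_cancel_right₀ _ (norm_ne_zero_iff.2 h0)]
  rw [hnorm, ← real_inner_self_eq_norm_sq]
  refine hsum.congr_fun fun k => ?_
  have hRe : ⟪r, e k⟫_ℝ = (√(lam k))⁻¹ * R (φ k) := by rw [inner_smul_right, hr]
  rw [HilbertBasis.coe_mkOfOrthogonalEqBot, real_inner_comm r (e k), hRe, sq_abs, ← sq, mul_pow,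
    inv_pow, Real.sq_sqrt (hlam k).le]

/-! ### Random series -/

section RandomSeries

variable {Ξ : Type*} [MeasurableSpace Ξ] {μ : Measure Ξ} [IsProbabilityMeasure μ]
  {w : ℕ → Ξ → ℝ}

theorem integral_sum_mul_eq_zero (hL : ∀ k, MemLp (w k) 2 μ) (h0 : ∀ k, ∫ ξ, w k ξ ∂μ = 0)
    (a : ℕ → ℝ) (s : Finset ℕ) : ∫ ξ, ∑ k ∈ s, a k * w k ξ ∂μ = 0 := by
  rw [integral_finsetSum _ fun k _ => ((hL k).integrable one_le_two).const_mul (a k)]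
  simp [integral_const_mul, h0]

/-- The second moment of a weighted sum of independent standardised variables. -/
theorem integral_sum_mul_sq (hL : ∀ k, MemLp (w k) 2 μ) (hind : iIndepFun w μ)
    (h0 : ∀ k, ∫ ξ, w k ξ ∂μ = 0) (h1 : ∀ k, variance (w k) μ = 1) (a : ℕ → ℝ)
    (s : Finset ℕ) : ∫ ξ, (∑ k ∈ s, a k * w k ξ) ^ 2 ∂μ = ∑ k ∈ s, a k ^ 2 := by
  have hmem : ∀ k, MemLp (fun ξ => a k * w k ξ) 2 μ := fun k => (hL k).const_mul (a k)
  have hvar := IndepFun.variance_sum (μ := μ) (X := fun k ξ => a k * w k ξ) (s := s)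
    (fun k _ => hmem k) fun i _ j _ hij => (hind.indepFun hij).comp
      (measurable_const_mul (a i)) (measurable_const_mul (a j))
  simp only [variance_const_mul, h1, mul_one] at hvar
  have hsum : MemLp (∑ k ∈ s, fun ξ => a k * w k ξ) 2 μ := memLp_finsetSum' s fun k _ => hmem k
  rw [← hvar, variance_of_integral_eq_zero hsum.aemeasurable
    (by simpa using integral_sum_mul_eq_zero hL h0 a s)]
  simp

/-- **Kolmogorov's one-series theorem**: a series of independent centred variables with summable
variances converges almost surely. Its partial sums are a martingale bounded in `L²`. -/
theorem ae_exists_tendsto_sum_mul (hm : ∀ k, Measurable (w k)) (hL : ∀ k, MemLp (w k) 2 μ)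
    (hind : iIndepFun w μ) (h0 : ∀ k, ∫ ξ, w k ξ ∂μ = 0) (h1 : ∀ k, variance (w k) μ = 1)
    {a : ℕ → ℝ} (ha : Summable fun k => a k ^ 2) :
    ∀ᵐ ξ ∂μ, ∃ l : ℝ, Tendsto (fun n => ∑ k ∈ Finset.range n, a k * w k ξ) atTop (𝓝 l) := by
  have hsm : ∀ k, StronglyMeasurable (w k) := fun k => (hm k).stronglyMeasurable
  let 𝒢 := Filtration.natural w hsm
  -- shifted by one, so that the `n`-th term involves `w 0, …, w n`
  let S : ℕ → Ξ → ℝ := fun n ξ => ∑ k ∈ Finset.range (n + 1), a k * w k ξ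
  have hmem : ∀ n, MemLp (S n) 2 μ := fun n =>
    memLp_finsetSum _ fun k _ => (hL k).const_mul (a k)
  have hint : ∀ n, Integrable (S n) μ := fun n => (hmem n).integrable one_le_two
  have hadp : StronglyAdapted 𝒢 S := fun n =>
    Finset.stronglyMeasurable_fun_sum _ fun k hk =>
      (((Filtration.stronglyAdapted_natural hsm) k).mono
        (𝒢.mono (Nat.lt_succ_iff.1 (Finset.mem_range.1 hk)))).const_mul (a k)
  have hmart : Martingale S 𝒢 μ := by
    refine martingale_of_condExp_sub_eq_zero_nat hadp hint fun i => ?_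
    have hS : S (i + 1) - S i = a (i + 1) • w (i + 1) := by
      ext ξ
      simp [S, Finset.sum_range_succ _ (i + 1)]
    rw [hS]
    filter_upwards [condExp_smul (μ := μ) (a (i + 1)) (w (i + 1)) (𝒢 i),
      hind.condExp_natural_ae_eq_of_lt hsm i.lt_succ_self] with ξ h2 h3
    rw [h2, Pi.smul_apply, h3, h0, smul_zero, Pi.zero_apply]
  have hbdd : ∀ n, eLpNorm (S n) 1 μ ≤ ((1 + ∑' k, a k ^ 2).toNNReal : ENNReal) := fun n => by
    rw [eLpNorm_one_eq_lintegral_enorm, ← ofReal_integral_norm_eq_lintegral_enorm (hint n)]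
    refine ENNReal.ofReal_le_ofReal ?_
    calc ∫ ξ, ‖S n ξ‖ ∂μ ≤ ∫ ξ, (1 + S n ξ ^ 2) ∂μ := by
          refine integral_mono (hint n).norm ((integrable_const 1).add (hmem n).integrable_sq)
            fun ξ => ?_
          change |S n ξ| ≤ 1 + S n ξ ^ 2
          nlinarith [sq_abs (S n ξ), sq_nonneg (|S n ξ| - 1)]
      _ = 1 + ∑ k ∈ Finset.range (n + 1), a k ^ 2 := by
          rw [integral_add (integrable_const 1) (hmem n).integrable_sq,
            integral_sum_mul_sq hL hind h0 h1]
          simp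
      _ ≤ 1 + ∑' k, a k ^ 2 := by
          gcongr
          exact ha.sum_le_tsum _ fun k _ => sq_nonneg _
  filter_upwards [hmart.submartingale.ae_tendsto_limitProcess hbdd] with ξ hξ
  exact ⟨_, (tendsto_add_atTop_iff_nat 1).1 hξ⟩

end RandomSeries

/-! ### Dirichlet eigensystems -/

/-- The weak gradient as a bounded operator `H₀¹(Ω) → L²(Ω; ℝ^d)`. -/
noncomputable def gradL {d : ℕ} (Ω : Opens (Eucl d)) : H01 Ω →L[ℝ] L2Vec Ω :=
  (WithLp.sndL 2 ℝ (L2 Ω) (L2Vec Ω)).comp (H01 Ω).subtypeL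

theorem gradL_apply {d : ℕ} {Ω : Opens (Eucl d)} (v : H01 Ω) : gradL Ω v = H01.grad v := rfl

theorem H01.norm_le {d : ℕ} {Ω : Opens (Eucl d)} {P : ℝ}
    (hP : ∀ v : H01 Ω, ‖H01.val v‖ ≤ P * ‖H01.grad v‖) (v : H01 Ω) :
    ‖v‖ ≤ √(P ^ 2 + 1) * ‖gradL Ω v‖ := by
  refine le_of_sq_le_sq ?_ (by positivity)
  have h : ‖v‖ ^ 2 = ‖H01.val v‖ ^ 2 + ‖H01.grad v‖ ^ 2 := by
    rw [Submodule.coe_norm, WithLp.prod_norm_sq_eq_of_L2]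
    rfl
  have h2 := pow_le_pow_left₀ (norm_nonneg _) (hP v) 2
  rw [mul_pow, Real.sq_sqrt (by positivity), gradL_apply, h]
  linarith

instance {d : ℕ} (Ω : Opens (Eucl d)) : CompleteSpace (H01 Ω) :=
  inferInstanceAs (CompleteSpace (Submodule.span ℝ (Set.range (testPair Ω))).topologicalClosure)

namespace IsDirichletEigensystem

variable {d : ℕ} {Ω : Opens (Eucl d)} {lam : ℕ → ℝ} {φ : ℕ → H01 Ω}

theorem norm_grad_sq (h : IsDirichletEigensystem Ω lam φ) (k : ℕ) :
    ‖H01.grad (φ k)‖ ^ 2 = lam k := by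
  rw [← real_inner_self_eq_norm_sq, h.weak_eigen, real_inner_self_eq_norm_sq, h.orthonormal.1]
  simp

theorem one_le_mul (h : IsDirichletEigensystem Ω lam φ) {P : ℝ}
    (hP : ∀ v : H01 Ω, ‖H01.val v‖ ≤ P * ‖H01.grad v‖) (k : ℕ) : 1 ≤ P ^ 2 * lam k := by
  have := pow_le_pow_left₀ (norm_nonneg _) (hP (φ k)) 2
  rwa [h.orthonormal.1, one_pow, mul_pow, h.norm_grad_sq] at this

theorem pos (h : IsDirichletEigensystem Ω lam φ) {P : ℝ}
    (hP : ∀ v : H01 Ω, ‖H01.val v‖ ≤ P * ‖H01.grad v‖) (k : ℕ) : 0 < lam k :=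
  pos_of_mul_pos_right (one_pos.trans_le (h.one_le_mul hP k)) (sq_nonneg P)

/-- Gradients of eigenfunctions are total among gradients: orthogonality in energy to every
eigenfunction is orthogonality in `L²(Ω)`, as eigenvalues are nonzero. -/
theorem grad_eq_zero (h : IsDirichletEigensystem Ω lam φ) (hpos : ∀ k, 0 < lam k) {v : H01 Ω}
    (hv : ∀ k, ⟪H01.grad (φ k), H01.grad v⟫_ℝ = 0) : H01.grad v = 0 := by
  refine H01.grad_eq_zero ?_
  have hmem : H01.val v ∈ (Submodule.span ℝ (Set.range fun k => H01.val (φ k)))ᗮ := by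
    rw [Submodule.mem_orthogonal]
    intro u hu
    induction hu using Submodule.span_induction with
    | mem u hu =>
      obtain ⟨k, rfl⟩ := hu
      have := hv k
      rw [h.weak_eigen, mul_eq_zero] at this
      exact this.resolve_left (hpos k).ne'
    | zero => exact inner_zero_left _
    | add x y _ _ hx hy => rw [inner_add_left, hx, hy, add_zero]
    | smul a x _ hx => rw [inner_smul_left, hx, mul_zero]
  rwa [(Submodule.topologicalClosure_eq_top_iff).1 h.complete, Submodule.mem_bot] at hmem

/-- The spectral formula for the dual norm. -/
theorem hasSum_dualNorm_sq (h : IsDirichletEigensystem Ω lam φ) {P : ℝ}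
    (hP : ∀ v : H01 Ω, ‖H01.val v‖ ≤ P * ‖H01.grad v‖) (R : HNegOne Ω) :
    HasSum (fun k => (lam k)⁻¹ * |R (φ k)| ^ 2) (dualNorm R ^ 2) :=
  hasSum_sq_iSup_div_norm (gradL Ω) (H01.norm_le hP) (h.pos hP) h.norm_grad_sq
    (fun i j hij => (h.weak_eigen i (φ j)).trans (mul_eq_zero_of_right _ (h.orthonormal.2 hij)))
    (fun _ hv => h.grad_eq_zero (h.pos hP) hv) R

end IsDirichletEigensystem

/-! ### Comparison of the two norms -/

theorem apply_randomPartialSum {d : ℕ} {Ω : Opens (Eucl d)} {Ξ : Type*} (τ : ℝ) (lam : ℕ → ℝ)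
    (φ : ℕ → H01 Ω) (w : ℕ → Ξ → ℝ) (R : HNegOne Ω) (n : ℕ) (ξ : Ξ) :
    R (randomPartialSum τ lam φ w n ξ) = ∑ k ∈ Finset.range n,
      (τ * (1 + lam k) ^ (-(1 / 2) : ℝ) * R (φ k)) * w k ξ := by
  simp only [randomPartialSum, map_smul, map_sum, smul_eq_mul, Finset.mul_sum]
  exact Finset.sum_congr rfl fun k _ => by ring

theorem proposition3p2 {d : ℕ} (hd : 1 ≤ d) (Ω : TopologicalSpace.Opens (Eucl d))
    (hΩ : Bornology.IsBounded (Ω : Set (Eucl d))) (τ : ℝ) (hτ : 0 < τ) :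
    -- the constants depend on `Ω` and `τ` only
    ∃ c C : ℝ, 0 < c ∧ 0 < C ∧
      ∀ (lam : ℕ → ℝ) (φ : ℕ → H01 Ω), IsDirichletEigensystem Ω lam φ →
      ∀ (Ξ : Type*) [MeasurableSpace Ξ] (μ : Measure Ξ) [IsProbabilityMeasure μ]
        (w : ℕ → Ξ → ℝ),
        (∀ k, Measurable (w k)) → (∀ k, MemLp (w k) 2 μ) → iIndepFun w μ →
        (∀ k, ∫ ξ, w k ξ ∂μ = 0) → (∀ k, variance (w k) μ = 1) →
      ∀ R : HNegOne Ω,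
        -- `R(Φ)` converges almost surely to a finite limit
        (∀ᵐ ξ ∂μ, ∃ l : ℝ,
          Tendsto (fun n => R (randomPartialSum τ lam φ w n ξ)) atTop (𝓝 l)) ∧
        -- the limit that defines `‖R‖_Φ²` exists
        Tendsto (fun n => ∫ ξ, |R (randomPartialSum τ lam φ w n ξ)| ^ 2 ∂μ) atTop
          (𝓝 (stochNormSq μ τ lam φ w R)) ∧
        -- the dual norm is also given by its spectral formula
        HasSum (fun k => (lam k)⁻¹ * |R (φ k)| ^ 2) (dualNorm R ^ 2) ∧
        -- equivalence of the norms
        c * stochNormSq μ τ lam φ w R ≤ dualNorm R ^ 2 ∧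
        dualNorm R ^ 2 ≤ C * stochNormSq μ τ lam φ w R := by
  obtain ⟨r, hr0, hr⟩ := hΩ.exists_pos_norm_le
  have hP : ∀ v : H01 Ω, ‖H01.val v‖ ≤ 2 * r * ‖H01.grad v‖ := H01.poincare hd hr0.le hr
  generalize 2 * r = P at hP
  refine ⟨(τ ^ 2)⁻¹, (1 + P ^ 2) * (τ ^ 2)⁻¹, by positivity, by positivity, ?_⟩
  intro lam φ h Ξ _ μ _ w hm hL hind h0 h1 R
  have hpos := h.pos hP
  have hsum := h.hasSum_dualNorm_sq hP R
  let a : ℕ → ℝ := fun k => τ * (1 + lam k) ^ (-(1 / 2) : ℝ) * R (φ k)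
  have ha : ∀ k, a k ^ 2 = τ ^ 2 * ((1 + lam k)⁻¹ * |R (φ k)| ^ 2) := fun k => by
    have h1' : 0 ≤ 1 + lam k := by linarith [hpos k]
    have : ((1 + lam k) ^ (-(1 / 2) : ℝ)) ^ 2 = (1 + lam k)⁻¹ := by
      rw [← Real.rpow_natCast, ← Real.rpow_mul h1', ← Real.rpow_neg_one]
      norm_num
    simp only [a, mul_pow, this, sq_abs]
    ring
  have hle : ∀ k, (τ ^ 2)⁻¹ * a k ^ 2 ≤ (lam k)⁻¹ * |R (φ k)| ^ 2 := fun k => by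
    rw [ha, inv_mul_cancel_left₀ (by positivity)]
    gcongr
    · exact hpos k
    · linarith
  have hge : ∀ k, (lam k)⁻¹ * |R (φ k)| ^ 2 ≤ (1 + P ^ 2) * (τ ^ 2)⁻¹ * a k ^ 2 := fun k => by
    rw [ha, mul_assoc, inv_mul_cancel_left₀ (by positivity), ← mul_assoc]
    gcongr
    -- the lower bound `1 ≤ P² λ_k` makes `1 + λ_k` comparable with `λ_k`
    have hk := hpos k
    rw [← div_eq_mul_inv, inv_eq_one_div, div_le_div_iff₀ hk (by linarith)]
    linarith [h.one_le_mul hP k]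
  have hsa : Summable fun k => a k ^ 2 := by
    refine (summable_mul_left_iff (inv_ne_zero (pow_ne_zero 2 hτ.ne'))).1
      (Summable.of_nonneg_of_le (fun k => by positivity) hle hsum.summable)
  have hlim : Tendsto (fun n => ∫ ξ, |R (randomPartialSum τ lam φ w n ξ)| ^ 2 ∂μ) atTop
      (𝓝 (∑' k, a k ^ 2)) := by
    simp only [apply_randomPartialSum, sq_abs, integral_sum_mul_sq hL hind h0 h1]
    exact hsa.hasSum.tendsto_sum_nat
  have hstoch : stochNormSq μ τ lam φ w R = ∑' k, a k ^ 2 := hlim.limUnder_eq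
  refine ⟨?_, hstoch ▸ hlim, hsum, ?_, ?_⟩
  · simp only [apply_randomPartialSum]
    exact ae_exists_tendsto_sum_mul hm hL hind h0 h1 hsa
  · rw [hstoch]
    exact hasSum_le hle (hsa.hasSum.mul_left _) hsum
  · rw [hstoch]
    exact hasSum_le hge hsum (hsa.hasSum.mul_left _)
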